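/- Let $[n]=\{1,\dots,n\}$. A family $\mathcal F$ of subsets of $[n]$ is intersecting if any two of its members have nonempty intersection. For $S\subseteq[n]$ the degree of $S$ is the number of members of $\mathcal F$ that contain $S$, and $\delta_t(\mathcal F)$ denotes the minimum of the degrees of all $t$-element subsets $S\subseteq[n]$. Binomial coefficients with a negative lower index are $0$. Let $n,k$ be integers and let $\mathcal F$ be an intersecting family of $k$-element subsets of $[n]$. (1) If $n\ge 2k+2>2$, then $\delta_1(\mathcal F)\le\binom{n-2}{k-2}$. (2) More generally, if $t$ is an integer with $1\le t<k$ and $n\ge 2k+\dfrac{3t}{1-\frac tk}$, then $\delta_t(\mathcal F)\le\binom{n-t-1}{k-t-1}$. -/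

import Mathlib

/-- The degree of a subset `S` of `[n]` in a family: the number of members containing `S`. -/
def setDegree {n : ℕ} (F : Finset (Finset (Fin n))) (S : Finset (Fin n)) : ℕ :=
  (F.filter (fun A => S ⊆ A)).card

/-- The minimum `t`-degree: the least degree of a `t`-element subset of `[n]`.
For `t ≤ n` the set below is nonempty, so the infimum in `ℕ` is a minimum. -/
noncomputable def minDegree {n : ℕ} (F : Finset (Finset (Fin n))) (t : ℕ) : ℕ :=
  sInf {d : ℕ | ∃ S : Finset (Fin n), S.card = t ∧ setDegree F S = d}

/-- The binomial coefficient with an integer lower index, zero when that index is negative. -/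
def binom (m : ℕ) (j : ℤ) : ℕ :=
  if j < 0 then 0 else m.choose j.toNat

open Finset
open scoped Finset FinsetFamily

/-! Suppose every `t`-set has degree above C(n-t-1, k-t-1). Counting pairs (S, A) with S ⊆ A over
the `t`-sets S avoiding a point x gives, with d(x) members through x and γ(x) members missing x, the
inequality (k-t)C(n-1,k-1) < (k-t)d(x) + kγ(x) (`mul_choose_lt_of_lt_setDegree`). It is used twice.

At a single x it forces γ(x) > C(n-3,k-2) (`choose_lt_card_filter_notMem`): the traces of the
members through x and of those missing x cross-intersect, so by Kruskal–Katona a smaller γ(x) leaves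
d(x) too small. Frankl's theorem (`card_le_of_choose_lt_card_filter_notMem`) then bounds |F| by
C(n-2,k-2) + 2C(n-3,k-2), the number of k-sets containing two of three fixed points. Summed over x,
the inequality gives n(k-t)C(n-1,k-1) < k(n-t)|F|, which contradicts this bound by arithmetic on
binomials.

Frankl's theorem is proved by shifting until the family is shifted or some γ(v) drops to at most
C(n-3,k-2). Either way the family is bounded directly, by splitting it along its traces on one or
two points and estimating cross-intersecting pairs through shadows of complements. For k ≥ 3 the
parameters are p = n-4 and q = k-3; k = 1 and k = 2 are done by hand. -/

/-- The `b`-element subsets of the members of a family. -/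
def lowerShadow {α : Type*} [DecidableEq α] (b : ℕ) (𝒜 : Finset (Finset α)) :
    Finset (Finset α) :=
  𝒜.biUnion (powersetCard b)

/-! ### Shadows, double counting, and cross-intersecting families. -/

section LowerShadow

variable {α : Type*} [DecidableEq α] {𝒜 ℬ : Finset (Finset α)} {X s : Finset α} {r b : ℕ}

lemma mem_lowerShadow : s ∈ lowerShadow b 𝒜 ↔ ∃ A ∈ 𝒜, s ⊆ A ∧ #s = b := by
  simp [lowerShadow, mem_powersetCard]

lemma lowerShadow_eq_iterate (h𝒜 : (𝒜 : Set (Finset α)).Sized r) (hb : b ≤ r) :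
    lowerShadow b 𝒜 = ∂^[r - b] 𝒜 := by
  ext s
  rw [mem_lowerShadow, mem_shadow_iterate_iff_exists_sdiff]
  refine exists_congr fun A => and_congr_right fun hA => and_congr_right fun hs => ?_
  have h1 := h𝒜 hA
  have h2 := card_sdiff_add_card_eq_card hs
  omega

lemma lowerShadow_mono (h : 𝒜 ⊆ ℬ) : lowerShadow b 𝒜 ⊆ lowerShadow b ℬ :=
  biUnion_subset_biUnion_of_subset_left _ h

/-- Double counting of the pairs `B ⊆ A` with `A ∈ 𝒜` and `#B = b`. -/
lemma card_mul_choose_le_lowerShadow (h𝒜 : 𝒜 ⊆ powersetCard r X) :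
    #𝒜 * r.choose b ≤ #(lowerShadow b 𝒜) * (#X - b).choose (r - b) := by
  refine card_mul_le_card_mul (fun A B => B ⊆ A) (fun A hA => ?_) (fun B hB => ?_)
  · have hA' := mem_powersetCard.1 (h𝒜 hA)
    rw [← hA'.2, ← card_powersetCard]
    refine card_le_card fun B hB => ?_
    rw [mem_powersetCard] at hB
    exact (mem_bipartiteAbove _).2 ⟨mem_lowerShadow.2 ⟨A, hA, hB.1, hB.2⟩, hB.1⟩
  · obtain ⟨A, hA, hBA, hBc⟩ := mem_lowerShadow.1 hB
    have hBX := hBA.trans (mem_powersetCard.1 (h𝒜 hA)).1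
    rw [← hBc, ← card_sdiff_of_subset hBX, hBc, ← card_powersetCard]
    refine card_le_card_of_injOn (· \ B) (fun C hC => ?_) (fun C hC D hD h => ?_)
    · have hC' := (mem_bipartiteBelow _).1 (mem_coe.1 hC)
      have hCX := mem_powersetCard.1 (h𝒜 hC'.1)
      refine mem_coe.2 (mem_powersetCard.2 ⟨sdiff_subset_sdiff hCX.1 le_rfl, ?_⟩)
      rw [card_sdiff_of_subset hC'.2, hCX.2, hBc]
    · have hC' := (mem_bipartiteBelow _).1 (mem_coe.1 hC)
      have hD' := (mem_bipartiteBelow _).1 (mem_coe.1 hD)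
      simp only at h
      rw [← sdiff_union_of_subset hC'.2, ← sdiff_union_of_subset hD'.2, h]

/-- On at most r + b points a `b`-set lies in no more `r`-sets than an `r`-set has `b`-subsets, so
the double count favours the shadow. -/
lemma card_le_card_lowerShadow (h𝒜 : 𝒜 ⊆ powersetCard r X) (hb : b ≤ r) (hX : #X ≤ r + b) :
    #𝒜 ≤ #(lowerShadow b 𝒜) := by
  have h1 := card_mul_choose_le_lowerShadow (b := b) h𝒜
  have h2 : (#X - b).choose (r - b) ≤ r.choose b := by
    rw [← Nat.choose_symm hb]
    exact Nat.choose_le_choose _ (by omega)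
  exact Nat.le_of_mul_le_mul_right (h1.trans (Nat.mul_le_mul_left _ h2)) (Nat.choose_pos hb)

/-- If every member of `𝒜` meets every member of `ℬ`, then `𝒜` avoids the shadow of the
complements of the members of `ℬ`. -/
lemma card_add_card_lowerShadow_le {a : ℕ} (h𝒜 : 𝒜 ⊆ powersetCard a X)
    (h : ∀ A ∈ 𝒜, ∀ B ∈ ℬ, ¬ Disjoint A B) :
    #𝒜 + #(lowerShadow a (ℬ.image (X \ ·))) ≤ (#X).choose a := by
  have hd : Disjoint 𝒜 (lowerShadow a (ℬ.image (X \ ·))) := by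
    rw [disjoint_left]
    intro A hA hA'
    obtain ⟨C, hC, hAC, -⟩ := mem_lowerShadow.1 hA'
    obtain ⟨B, hB, rfl⟩ := mem_image.1 hC
    exact h A hA B hB (disjoint_of_subset_left hAC sdiff_disjoint)
  rw [← card_union_of_disjoint hd, ← card_powersetCard]
  refine card_le_card (union_subset h𝒜 fun A hA => ?_)
  obtain ⟨C, hC, hAC, hc⟩ := mem_lowerShadow.1 hA
  obtain ⟨B, hB, rfl⟩ := mem_image.1 hC
  exact mem_powersetCard.2 ⟨hAC.trans sdiff_subset, hc⟩

lemma card_image_compl (hℬ : ℬ ⊆ powersetCard r X) : #(ℬ.image (X \ ·)) = #ℬ := by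
  refine card_image_of_injOn fun A hA B hB h => ?_
  have hA := (mem_powersetCard.1 (hℬ hA)).1
  have hB := (mem_powersetCard.1 (hℬ hB)).1
  have h : X \ A = X \ B := h
  rw [← Finset.sdiff_sdiff_eq_self hA, ← Finset.sdiff_sdiff_eq_self hB, h]

lemma image_compl_subset (hℬ : ℬ ⊆ powersetCard r X) :
    ℬ.image (X \ ·) ⊆ powersetCard (#X - r) X := by
  intro C hC
  obtain ⟨B, hB, rfl⟩ := mem_image.1 hC
  have hB := mem_powersetCard.1 (hℬ hB)
  exact mem_powersetCard.2 ⟨sdiff_subset, by rw [card_sdiff_of_subset hB.1, hB.2]⟩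

end LowerShadow

/-! ### Consequences of the Kruskal–Katona theorem. -/

section KruskalKatona

open Colex

variable {n : ℕ}

/-- The first `m` elements of `Fin n`. -/
def lowerFin (n m : ℕ) : Finset (Fin n) := univ.filter fun i => (i : ℕ) < m

lemma card_lowerFin {m : ℕ} (hm : m ≤ n) : #(lowerFin n m) = m := by
  rw [lowerFin, Fin.card_filter_val_lt, min_eq_right hm]

lemma isInitSeg_powersetCard_lowerFin (m r : ℕ) :
    IsInitSeg (powersetCard r (lowerFin n m)) r := by
  refine ⟨Set.sized_powersetCard _ _, ?_⟩
  rintro A B hA ⟨hBA, hB⟩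
  rw [mem_powersetCard] at hA ⊢
  refine ⟨fun t ht => ?_, hB⟩
  have h : toColex (image Fin.val B) < toColex (image Fin.val A) := by
    rwa [toColex_image_lt_toColex_image Fin.val_strictMono]
  have := Colex.forall_lt_mono (a := m) h.le ?_ t (mem_image.2 ⟨t, ht, rfl⟩)
  · simpa [lowerFin] using this
  · simp_rw [mem_image]
    rintro _ ⟨a, ha, rfl⟩
    simpa [lowerFin] using hA.1 ha

lemma exists_isInitSeg_card (r c : ℕ) (hc : c ≤ n.choose r) :
    ∃ 𝒞 : Finset (Finset (Fin n)), IsInitSeg 𝒞 r ∧ #𝒞 = c := by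
  induction c with
  | zero => exact ⟨∅, isInitSeg_empty, rfl⟩
  | succ c ih =>
    obtain ⟨𝒞, h𝒞, hcard⟩ := ih (by omega)
    have hsub : 𝒞 ⊆ powersetCard r univ := fun A hA => by simpa using h𝒞.1 hA
    have hne : (powersetCard r univ \ 𝒞).Nonempty := by
      rw [← card_pos, card_sdiff_of_subset hsub, card_powersetCard, card_univ, Fintype.card_fin]
      omega
    -- Adding the colex-least missing set keeps the family an initial segment.
    obtain ⟨s, hs, hmin⟩ := exists_min_image _ toColex hne
    rw [mem_sdiff, mem_powersetCard] at hs
    refine ⟨insert s 𝒞, ⟨?_, ?_⟩, by rw [card_insert_of_notMem hs.2, hcard]⟩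
    · intro A hA
      rcases mem_insert.1 (mem_coe.1 hA) with rfl | hA
      · exact hs.1.2
      · exact h𝒞.1 hA
    · rintro A B hA ⟨hBA, hB⟩
      rcases mem_insert.1 hA with rfl | hA
      · by_contra hBm
        rw [mem_insert, not_or] at hBm
        exact (hmin B (by simp [hB, hBm.2])).not_gt hBA
      · exact mem_insert_of_mem (h𝒞.2 hA ⟨hBA, hB⟩)

lemma card_le_choose_of_sized {𝒜 : Finset (Finset (Fin n))} {r : ℕ}
    (h𝒜 : (𝒜 : Set (Finset (Fin n))).Sized r) : #𝒜 ≤ n.choose r := by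
  simpa using h𝒜.card_le

/-- The Kruskal–Katona theorem: a colex initial segment minimises the lower shadow. -/
lemma exists_isInitSeg_lowerShadow_le {𝒜 : Finset (Finset (Fin n))} {r b : ℕ}
    (h𝒜 : (𝒜 : Set (Finset (Fin n))).Sized r) (hb : b ≤ r) :
    ∃ 𝒞 : Finset (Finset (Fin n)), IsInitSeg 𝒞 r ∧ #𝒞 = #𝒜 ∧
      #(lowerShadow b 𝒞) ≤ #(lowerShadow b 𝒜) := by
  obtain ⟨𝒞, h𝒞, hcard⟩ := exists_isInitSeg_card r #𝒜 (card_le_choose_of_sized h𝒜)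
  refine ⟨𝒞, h𝒞, hcard, ?_⟩
  rw [lowerShadow_eq_iterate h𝒜 hb, lowerShadow_eq_iterate h𝒞.1 hb]
  exact iterated_kk h𝒜 hcard.le h𝒞

lemma IsInitSeg_subset_of_card_le {𝒞 𝒟 : Finset (Finset (Fin n))} {r : ℕ}
    (h𝒞 : IsInitSeg 𝒞 r) (h𝒟 : IsInitSeg 𝒟 r) (h : #𝒞 ≤ #𝒟) : 𝒞 ⊆ 𝒟 := by
  rcases h𝒞.total h𝒟 with h1 | h1
  · exact h1
  · exact (eq_of_subset_of_card_le h1 h).ge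

/-- A small family satisfies the local LYM inequality of a ground set of `m` points. -/
lemma card_mul_choose_le_of_card_le {𝒜 : Finset (Finset (Fin n))} {r b m : ℕ}
    (h𝒜 : (𝒜 : Set (Finset (Fin n))).Sized r) (hb : b ≤ r) (hm : m ≤ n)
    (hcard : #𝒜 ≤ m.choose r) :
    #𝒜 * r.choose b ≤ #(lowerShadow b 𝒜) * (m - b).choose (r - b) := by
  obtain ⟨𝒞, h𝒞, hc, hle⟩ := exists_isInitSeg_lowerShadow_le h𝒜 hb
  have hsub : 𝒞 ⊆ powersetCard r (lowerFin n m) :=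
    IsInitSeg_subset_of_card_le h𝒞 (isInitSeg_powersetCard_lowerFin m r)
      (by rwa [card_powersetCard, card_lowerFin hm, hc])
  have := card_mul_choose_le_lowerShadow (b := b) hsub
  rw [card_lowerFin hm, hc] at this
  exact this.trans (Nat.mul_le_mul_right _ hle)

lemma card_le_lowerShadow_of_card_le {𝒜 : Finset (Finset (Fin n))} {r b m : ℕ}
    (h𝒜 : (𝒜 : Set (Finset (Fin n))).Sized r) (hb : b ≤ r) (hm : m ≤ n) (hmrb : m ≤ r + b)
    (hcard : #𝒜 ≤ m.choose r) : #𝒜 ≤ #(lowerShadow b 𝒜) := by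
  have h1 := card_mul_choose_le_of_card_le h𝒜 hb hm hcard
  have h2 : (m - b).choose (r - b) ≤ r.choose b := by
    rw [← Nat.choose_symm hb]
    exact Nat.choose_le_choose _ (by omega)
  exact Nat.le_of_mul_le_mul_right (h1.trans (Nat.mul_le_mul_left _ h2)) (Nat.choose_pos hb)

lemma choose_le_lowerShadow {𝒜 : Finset (Finset (Fin n))} {r b m : ℕ}
    (h𝒜 : (𝒜 : Set (Finset (Fin n))).Sized r) (hb : b ≤ r) (hrm : r ≤ m) (hm : m ≤ n)
    (hcard : m.choose r ≤ #𝒜) : m.choose b ≤ #(lowerShadow b 𝒜) := by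
  have := kruskal_katona_lovasz_form (i := r - b) (by omega) hrm hm h𝒜 hcard
  rwa [Nat.sub_sub_self hb, ← lowerShadow_eq_iterate h𝒜 hb] at this

/-- Between two consecutive binomial coefficients, the shadow grows at least as fast as
the family. -/
lemma card_add_choose_le_lowerShadow {𝒜 : Finset (Finset (Fin n))} {r b m : ℕ}
    (h𝒜 : (𝒜 : Set (Finset (Fin n))).Sized (r + 1)) (hb : b ≤ r) (hrm : r + 1 ≤ m)
    (hm : m + 1 ≤ n) (hmrb : m ≤ r + b) (hlo : m.choose (r + 1) ≤ #𝒜)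
    (hhi : #𝒜 ≤ (m + 1).choose (r + 1)) :
    #𝒜 + m.choose (b + 1) ≤ #(lowerShadow (b + 1) 𝒜) + m.choose (r + 1) := by
  obtain ⟨𝒞, h𝒞, hc, hle⟩ := exists_isInitSeg_lowerShadow_le h𝒜 (Nat.add_le_add_right hb 1)
  have hsub : 𝒞 ⊆ powersetCard (r + 1) (lowerFin n (m + 1)) :=
    IsInitSeg_subset_of_card_le h𝒞 (isInitSeg_powersetCard_lowerFin _ _)
      (by rwa [card_powersetCard, card_lowerFin hm, hc])
  have hsup : powersetCard (r + 1) (lowerFin n m) ⊆ 𝒞 :=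
    IsInitSeg_subset_of_card_le (isInitSeg_powersetCard_lowerFin _ _) h𝒞
      (by rwa [card_powersetCard, card_lowerFin (by omega), hc])
  let z : Fin n := ⟨m, hm⟩
  have hz : z ∉ lowerFin n m := by simp [lowerFin, z]
  have hins : lowerFin n (m + 1) = insert z (lowerFin n m) := by
    ext i
    simp only [lowerFin, mem_filter, mem_univ, true_and, mem_insert, Fin.ext_iff, z]
    omega
  -- The initial segment consists of all sets on the first m points and the sets z ∪ D with D ∈ 𝒟.
  -- Its shadow contains every (b+1)-set on those m points and z ∪ E for each E in the shadow of 𝒟;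
  -- as m ≤ r + b, the latter are at least as many as 𝒟.
  let 𝒟 : Finset (Finset (Fin n)) := (powersetCard r (lowerFin n m)).filter (insert z · ∈ 𝒞)
  have h𝒟 : 𝒟 ⊆ powersetCard r (lowerFin n m) := filter_subset _ _
  have hinj : Set.InjOn (insert z : Finset (Fin n) → _) {s | z ∉ s} := fun s hs t ht h => by
    rw [← erase_insert hs, ← erase_insert ht, h]
  have h1 : 𝒞 ⊆ powersetCard (r + 1) (lowerFin n m) ∪ 𝒟.image (insert z) := by
    intro A hA
    have hA' := hsub hA
    rw [hins, powersetCard_succ_insert hz, mem_union] at hA'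
    rcases hA' with h | h
    · exact mem_union_left _ h
    · obtain ⟨D, hD, rfl⟩ := mem_image.1 h
      exact mem_union_right _ (mem_image_of_mem _ (mem_filter.2 ⟨hD, hA⟩))
  have h2 : #𝒜 ≤ m.choose (r + 1) + #𝒟 := by
    rw [← hc]
    refine (card_le_card h1).trans ((card_union_le _ _).trans ?_)
    rw [card_powersetCard, card_lowerFin (by omega)]
    exact Nat.add_le_add_left card_image_le _
  have h3 : #𝒟 ≤ #(lowerShadow b 𝒟) :=
    card_le_card_lowerShadow h𝒟 hb (by rw [card_lowerFin (by omega)]; exact hmrb)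
  have hDz : ∀ B ∈ lowerShadow b 𝒟, z ∉ B := fun B hB hzB => by
    obtain ⟨D, hD, hBD, -⟩ := mem_lowerShadow.1 hB
    exact hz ((mem_powersetCard.1 (h𝒟 hD)).1 (hBD hzB))
  have h4 : powersetCard (b + 1) (lowerFin n m) ∪ (lowerShadow b 𝒟).image (insert z) ⊆
      lowerShadow (b + 1) 𝒞 := by
    refine union_subset (fun B hB => ?_) (fun B hB => ?_)
    · rw [mem_powersetCard] at hB
      obtain ⟨A, hBA, hAm, hA⟩ := exists_subsuperset_card_eq hB.1 (n := r + 1) (by omega)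
        (by rw [card_lowerFin (by omega)]; exact hrm)
      exact mem_lowerShadow.2 ⟨A, hsup (mem_powersetCard.2 ⟨hAm, hA⟩), hBA, hB.2⟩
    · obtain ⟨E, hE, rfl⟩ := mem_image.1 hB
      have hzE := hDz E hE
      obtain ⟨D, hD, hED, hEb⟩ := mem_lowerShadow.1 hE
      exact mem_lowerShadow.2 ⟨insert z D, (mem_filter.1 hD).2, insert_subset_insert _ hED,
        by rw [card_insert_of_notMem hzE, hEb]⟩
  have hdisj : Disjoint (powersetCard (b + 1) (lowerFin n m))
      ((lowerShadow b 𝒟).image (insert z)) := by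
    rw [disjoint_left]
    intro B hB hB'
    obtain ⟨E, hE, rfl⟩ := mem_image.1 hB'
    exact hz ((mem_powersetCard.1 hB).1 (mem_insert_self _ _))
  have h5 := card_le_card h4
  rw [card_union_of_disjoint hdisj, card_powersetCard, card_lowerFin (by omega),
    card_image_of_injOn fun s hs t ht h => hinj (hDz s hs) (hDz t ht) h] at h5
  omega

end KruskalKatona

/-! ### Katona's shadow theorem, by induction on the ground set. -/

section Katona

/-- A family is shifted on `X` with respect to `f` if replacing an element of a member by an
element of `X` with a smaller value of `f` gives a member again. -/
def IsShiftedOn {α β : Type*} [DecidableEq α] [LT β] (f : α → β) (X : Finset α)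
    (𝒜 : Finset (Finset α)) : Prop :=
  ∀ A ∈ 𝒜, ∀ i ∈ X, ∀ j ∈ A, f i < f j → i ∉ A → insert i (A.erase j) ∈ 𝒜

/-- Katona's theorem on the shadows of `t`-intersecting families, for shifted families. -/
theorem card_le_lowerShadow_of_isShiftedOn {α β : Type*} [DecidableEq α] [LinearOrder β]
    {f : α → β} (hf : f.Injective) (t : ℕ) (X : Finset α) :
    ∀ (r b : ℕ) (𝒜 : Finset (Finset α)), 𝒜 ⊆ powersetCard r X → b ≤ r → r ≤ b + t →
      (∀ A ∈ 𝒜, ∀ B ∈ 𝒜, t ≤ #(A ∩ B)) → IsShiftedOn f X 𝒜 → #𝒜 ≤ #(lowerShadow b 𝒜) := by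
  induction X using Finset.induction_on_max_value f with
  | empty =>
    intro r b 𝒜 h𝒜 hb _ _ _
    exact card_le_card_lowerShadow h𝒜 hb (by simp)
  | insert m X hmX hmax ih =>
    intro r b 𝒜 h𝒜 hb hrb hint hsh
    have hm : ∀ x ∈ X, f x < f m := fun x hx =>
      (hmax x hx).lt_of_ne fun h => hmX (hf h ▸ hx)
    have hne : ∀ x ∈ X, x ≠ m := fun x hx h => hmX (h ▸ hx)
    by_cases hX : #(insert m X) ≤ r + b
    · exact card_le_card_lowerShadow h𝒜 hb hX
    rw [card_insert_of_notMem hmX] at hX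
    have hsize : ∀ A ∈ 𝒜, #A = r := fun A hA => (mem_powersetCard.1 (h𝒜 hA)).2
    have hXA : ∀ A ∈ 𝒜, ∀ x ∈ A, x ≠ m → x ∈ X := fun A hA x hx hxm =>
      mem_of_mem_insert_of_ne ((mem_powersetCard.1 (h𝒜 hA)).1 hx) hxm
    -- For b = 0 one has r ≤ t, so any two members coincide.
    rcases Nat.eq_zero_or_pos b with rfl | hb0
    · have : #𝒜 ≤ 1 := by
        refine card_le_one.2 fun A hA B hB => ?_
        have h1 := hint A hA B hB
        have h2 := eq_of_subset_of_card_le (inter_subset_left (s₁ := A) (s₂ := B))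
          (by rw [hsize A hA]; omega)
        have h3 := eq_of_subset_of_card_le (inter_subset_right (s₁ := A) (s₂ := B))
          (by rw [hsize B hB]; omega)
        exact h2.symm.trans h3
      rcases 𝒜.eq_empty_or_nonempty with rfl | ⟨A, hA⟩
      · simp
      · exact this.trans (card_pos.2 ⟨∅, mem_lowerShadow.2 ⟨A, hA, empty_subset _, rfl⟩⟩)
    obtain ⟨c, rfl⟩ : ∃ c, b = c + 1 := ⟨b - 1, by omega⟩
    obtain ⟨s, rfl⟩ : ∃ s, r = s + 1 := ⟨r - 1, by omega⟩
    let 𝒜₀ := 𝒜.filter (m ∉ ·)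
    let 𝒜₁ := (𝒜.filter (m ∈ ·)).image (·.erase m)
    have h0 : #𝒜₀ ≤ #(lowerShadow (c + 1) 𝒜₀) := by
      refine ih (s + 1) (c + 1) 𝒜₀ (fun A hA => ?_) hb hrb (fun A hA B hB => ?_)
        (fun A hA i hi j hj hij hiA => ?_)
      · have hA := mem_filter.1 hA
        exact mem_powersetCard.2 ⟨fun x hx => hXA A hA.1 x hx (by rintro rfl; exact hA.2 hx),
          hsize A hA.1⟩
      · exact hint A (mem_filter.1 hA).1 B (mem_filter.1 hB).1
      · have hA := mem_filter.1 hA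
        refine mem_filter.2 ⟨hsh A hA.1 i (mem_insert_of_mem hi) j hj hij hiA, ?_⟩
        rw [mem_insert, not_or]
        exact ⟨(hne i hi).symm, fun h => hA.2 (mem_of_mem_erase h)⟩
    have mem1 : ∀ A, A ∈ 𝒜₁ ↔ m ∉ A ∧ insert m A ∈ 𝒜 := by
      intro A
      simp only [𝒜₁, mem_image, mem_filter]
      constructor
      · rintro ⟨B, ⟨hB, hmB⟩, rfl⟩
        exact ⟨notMem_erase _ _, by rwa [insert_erase hmB]⟩
      · rintro ⟨hmA, hA⟩
        exact ⟨insert m A, ⟨hA, mem_insert_self _ _⟩, erase_insert hmA⟩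
    have h1 : #𝒜₁ ≤ #(lowerShadow c 𝒜₁) := by
      refine ih s c 𝒜₁ (fun A hA => ?_) (by omega) (by omega) (fun A hA B hB => ?_)
        (fun A hA i hi j hj hij hiA => ?_)
      · obtain ⟨hmA, hA⟩ := (mem1 A).1 hA
        refine mem_powersetCard.2 ⟨fun x hx => hXA _ hA x (mem_insert_of_mem hx)
          (by rintro rfl; exact hmA hx), ?_⟩
        have := hsize _ hA
        rw [card_insert_of_notMem hmA] at this
        omega
      · obtain ⟨hmA, hA⟩ := (mem1 A).1 hA
        obtain ⟨hmB, hB⟩ := (mem1 B).1 hB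
        have hAs := hsize _ hA
        have hBs := hsize _ hB
        rw [card_insert_of_notMem hmA] at hAs
        rw [card_insert_of_notMem hmB] at hBs
        -- Deleting m could only cost one common element. If it did, A ∪ B would be too small to
        -- cover X, and shifting m to an uncovered i in one of the two sets would bring the
        -- intersection in 𝒜 below t.
        by_contra hlt
        have hAB := hint _ hA _ hB
        rw [← insert_inter_distrib, card_insert_of_notMem (by simp [hmA])] at hAB
        have hun := card_union_add_card_inter A B
        have : ∃ i ∈ X, i ∉ A ∪ B := by
          by_contra! hno
          have := card_le_card (show X ⊆ A ∪ B from hno)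
          omega
        obtain ⟨i, hiX, hi⟩ := this
        rw [mem_union, not_or] at hi
        have him := hm i hiX
        have hA' := hsh _ hA i (mem_insert_of_mem hiX) m (mem_insert_self _ _) him
          (by simp [hi.1, hne i hiX])
        rw [erase_insert hmA] at hA'
        have h := hint _ hA' _ hB
        have : insert i A ∩ insert m B = A ∩ B := by
          ext x
          simp only [mem_inter, mem_insert]
          constructor
          · rintro ⟨rfl | h1, rfl | h2⟩
            · exact absurd rfl (hne _ hiX)
            · exact absurd h2 hi.2
            · exact absurd h1 hmA
            · exact ⟨h1, h2⟩
          · exact fun h => ⟨Or.inr h.1, Or.inr h.2⟩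
        rw [this] at h
        omega
      · obtain ⟨hmA, hA⟩ := (mem1 A).1 hA
        have hmj : m ≠ j := by rintro rfl; exact hmA hj
        have hmi : m ≠ i := (hne i hi).symm
        refine (mem1 _).2 ⟨by simp [hmi, hmA], ?_⟩
        have := hsh _ hA i (mem_insert_of_mem hi) j (mem_insert_of_mem hj) hij
          (by simp [hmi.symm, hiA])
        rwa [erase_insert_of_ne hmj, insert_comm] at this
    have hcard : #𝒜 = #𝒜₀ + #𝒜₁ := by
      rw [card_image_of_injOn, add_comm]
      · exact (card_filter_add_card_filter_not _).symm
      · intro A hA B hB h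
        simp only at h
        rw [← insert_erase (mem_filter.1 (mem_coe.1 hA)).2,
          ← insert_erase (mem_filter.1 (mem_coe.1 hB)).2, h]
    have hm1 : ∀ B ∈ lowerShadow c 𝒜₁, m ∉ B := fun B hB hmB => by
      obtain ⟨D, hD, hBD, -⟩ := mem_lowerShadow.1 hB
      exact ((mem1 D).1 hD).1 (hBD hmB)
    have hdisj : Disjoint (lowerShadow (c + 1) 𝒜₀) ((lowerShadow c 𝒜₁).image (insert m)) := by
      rw [disjoint_left]
      intro B hB hB'
      obtain ⟨E, hE, rfl⟩ := mem_image.1 hB'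
      obtain ⟨A, hA, hEA, -⟩ := mem_lowerShadow.1 hB
      exact (mem_filter.1 hA).2 (hEA (mem_insert_self _ _))
    have hsub : lowerShadow (c + 1) 𝒜₀ ∪ (lowerShadow c 𝒜₁).image (insert m) ⊆
        lowerShadow (c + 1) 𝒜 := by
      refine union_subset (lowerShadow_mono (filter_subset _ _)) (fun B hB => ?_)
      obtain ⟨E, hE, rfl⟩ := mem_image.1 hB
      have hmE := hm1 E hE
      obtain ⟨D, hD, hED, hEb⟩ := mem_lowerShadow.1 hE
      exact mem_lowerShadow.2 ⟨insert m D, ((mem1 D).1 hD).2, insert_subset_insert _ hED,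
        by rw [card_insert_of_notMem hmE, hEb]⟩
    have hfin := card_le_card hsub
    rw [card_union_of_disjoint hdisj, card_image_of_injOn] at hfin
    · omega
    · intro s hs t ht h
      rw [← erase_insert (hm1 s hs), ← erase_insert (hm1 t ht), h]

end Katona

/-! ### Traces of a family on a small set of points. -/

section Link

variable {α : Type*} [DecidableEq α] {𝒢 : Finset (Finset α)} {X Y P Q B : Finset α} {k : ℕ}

/-- The traces outside `Y` of the members of `𝒢` that meet `Y` in `P`. -/
def link (𝒢 : Finset (Finset α)) (Y P : Finset α) : Finset (Finset α) :=
  (𝒢.filter (· ∩ Y = P)).image (· \ Y)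

lemma card_link : #(link 𝒢 Y P) = #(𝒢.filter (· ∩ Y = P)) := by
  refine card_image_of_injOn fun A hA B hB h => ?_
  have h' : A \ Y = B \ Y := h
  rw [← sdiff_union_inter A Y, ← sdiff_union_inter B Y, h', (mem_filter.1 hA).2,
    (mem_filter.1 hB).2]

lemma mem_link (hP : P ⊆ Y) : B ∈ link 𝒢 Y P ↔ Disjoint B Y ∧ B ∪ P ∈ 𝒢 := by
  simp only [link, mem_image, mem_filter]
  constructor
  · rintro ⟨A, ⟨hA, rfl⟩, rfl⟩
    exact ⟨sdiff_disjoint, by rwa [sdiff_union_inter]⟩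
  · rintro ⟨hd, hB⟩
    refine ⟨B ∪ P, ⟨hB, ?_⟩, ?_⟩
    · rw [union_inter_distrib_right, disjoint_iff_inter_eq_empty.1 hd, empty_union,
        inter_eq_left.2 hP]
    · rw [union_sdiff_distrib, sdiff_eq_empty_iff_subset.2 hP, union_empty,
        sdiff_eq_self_of_disjoint hd]

lemma link_subset_powersetCard [Fintype α] (h𝒢 : (𝒢 : Set (Finset α)).Sized k) (hP : P ⊆ Y) :
    link 𝒢 Y P ⊆ powersetCard (k - #P) Yᶜ := by
  intro B hB
  obtain ⟨hd, hB⟩ := (mem_link hP).1 hB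
  refine mem_powersetCard.2 ⟨subset_compl_iff_disjoint_right.2 hd, ?_⟩
  have := h𝒢 hB
  rw [card_union_of_disjoint (disjoint_of_subset_right hP hd)] at this
  omega

lemma not_disjoint_of_mem_link (h𝒢 : (𝒢 : Set (Finset α)).Intersecting) (hP : P ⊆ Y)
    (hQ : Q ⊆ Y) (hPQ : Disjoint P Q) :
    ∀ A ∈ link 𝒢 Y P, ∀ B ∈ link 𝒢 Y Q, ¬ Disjoint A B := by
  intro A hA B hB hAB
  obtain ⟨hA, hA'⟩ := (mem_link hP).1 hA
  obtain ⟨hB, hB'⟩ := (mem_link hQ).1 hB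
  refine h𝒢 hA' hB' ?_
  rw [disjoint_union_left, disjoint_union_right, disjoint_union_right]
  exact ⟨⟨hAB, disjoint_of_subset_right hQ hA⟩, (disjoint_of_subset_right hP hB).symm, hPQ⟩

lemma sum_card_link : ∑ P ∈ Y.powerset, #(link 𝒢 Y P) = #𝒢 := by
  simp_rw [card_link]
  exact (card_eq_sum_card_fiberwise fun A _ => mem_coe.2 (mem_powerset.2 inter_subset_right)).symm

lemma card_link_empty_singleton (i : α) : #(link 𝒢 {i} ∅) = #(𝒢.filter (i ∉ ·)) := by
  rw [card_link]
  congr 1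
  ext A
  simp [← disjoint_iff_inter_eq_empty]

lemma card_link_singleton_singleton (i : α) : #(link 𝒢 {i} {i}) = #(𝒢.filter (i ∈ ·)) := by
  rw [card_link]
  congr 1
  ext A
  simp

lemma sum_card_link_pair {i j : α} (hij : i ≠ j) :
    #(link 𝒢 {i, j} ∅) + #(link 𝒢 {i, j} {i}) + #(link 𝒢 {i, j} {j}) + #(link 𝒢 {i, j} {i, j})
      = #𝒢 := by
  rw [← sum_card_link (𝒢 := 𝒢) (Y := {i, j}), sum_powerset_insert (by simpa using hij),
    ← insert_empty_eq j, sum_powerset_insert (by simp), sum_powerset_insert (by simp)]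
  simp
  ring

lemma card_link_pair_empty_add {i j : α} (hij : i ≠ j) :
    #(link 𝒢 {i, j} ∅) + #(link 𝒢 {i, j} {j}) = #(𝒢.filter (i ∉ ·)) := by
  rw [card_link, card_link, ← card_filter_add_card_filter_not (s := 𝒢.filter (i ∉ ·)) (j ∉ ·),
    filter_filter, filter_filter]
  congr 2
  · ext A
    simp only [mem_filter, and_congr_right_iff, ← disjoint_iff_inter_eq_empty]
    simp
  · ext A
    simp only [mem_filter, and_congr_right_iff, not_not]
    intro _
    by_cases hi : i ∈ A <;> by_cases hj : j ∈ A <;> simp [hi, hj, hij, inter_insert_of_mem,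
      inter_insert_of_notMem]

end Link

/-! ### The shifting operation. -/

section Shift

variable {α : Type*} [DecidableEq α] {𝒢 : Finset (Finset α)} {i j v : α} {A B : Finset α} {k : ℕ}

/-- The action of the shift of `𝒢` from `j` to `i` on a member of `𝒢`. -/
def shiftSet (i j : α) (𝒢 : Finset (Finset α)) (A : Finset α) : Finset α :=
  if j ∈ A ∧ i ∉ A ∧ insert i (A.erase j) ∉ 𝒢 then insert i (A.erase j) else A

/-- The shift of `𝒢` from `j` to `i`. -/
def shiftFamily (i j : α) (𝒢 : Finset (Finset α)) : Finset (Finset α) :=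
  𝒢.image (shiftSet i j 𝒢)

lemma erase_insert_insert_erase (hj : j ∈ A) (hi : i ∉ A) :
    insert j ((insert i (A.erase j)).erase i) = A := by
  rw [erase_insert (by simp [hi]), insert_erase hj]

lemma shiftSet_injOn : Set.InjOn (shiftSet i j 𝒢) 𝒢 := by
  intro A hA B hB h
  unfold shiftSet at h
  split_ifs at h with h1 h2 h2
  · rw [← erase_insert_insert_erase h1.1 h1.2.1, h, erase_insert_insert_erase h2.1 h2.2.1]
  · exact absurd (h ▸ hB) h1.2.2
  · exact absurd (h ▸ hA) h2.2.2
  · exact h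

lemma card_shiftFamily : #(shiftFamily i j 𝒢) = #𝒢 := card_image_of_injOn shiftSet_injOn

lemma card_shiftSet : #(shiftSet i j 𝒢 A) = #A := by
  unfold shiftSet
  split_ifs with h
  · rw [card_insert_of_notMem (by simp [h.2.1]), card_erase_add_one h.1]
  · rfl

lemma sized_shiftFamily (h𝒢 : (𝒢 : Set (Finset α)).Sized k) :
    (shiftFamily i j 𝒢 : Set (Finset α)).Sized k := by
  intro A hA
  obtain ⟨B, hB, rfl⟩ := mem_image.1 (mem_coe.1 hA)
  rw [card_shiftSet, h𝒢 hB]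

/-- Only a moved set against an unmoved A is delicate. If they were disjoint, A would contain j and
miss i, so A stayed because its image is already in 𝒢; that image would then be disjoint from the
original of the moved set. -/
lemma intersecting_shiftFamily (h𝒢 : (𝒢 : Set (Finset α)).Intersecting) :
    (shiftFamily i j 𝒢 : Set (Finset α)).Intersecting := by
  have key : ∀ A ∈ 𝒢, ∀ B ∈ 𝒢, ¬ (j ∈ A ∧ i ∉ A ∧ insert i (A.erase j) ∉ 𝒢) →
      (j ∈ B ∧ i ∉ B ∧ insert i (B.erase j) ∉ 𝒢) → ¬ Disjoint A (insert i (B.erase j)) := by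
    intro A hA B hB h1 h2 hd
    rw [disjoint_insert_right] at hd
    have hjA : j ∈ A := by
      by_contra hjA
      refine h𝒢 hA hB ?_
      rw [← insert_erase h2.1, disjoint_insert_right]
      exact ⟨hjA, hd.2⟩
    have hA' : insert i (A.erase j) ∈ 𝒢 := by
      by_contra hA'
      exact h1 ⟨hjA, hd.1, hA'⟩
    refine h𝒢 hA' hB ?_
    rw [disjoint_insert_left, ← insert_erase h2.1, disjoint_insert_right]
    refine ⟨by rw [insert_erase h2.1]; exact h2.2.1, notMem_erase _ _,
      disjoint_of_subset_left (erase_subset _ _) hd.2⟩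
  intro A' hA' B' hB'
  obtain ⟨A, hA, rfl⟩ := mem_image.1 (mem_coe.1 hA')
  obtain ⟨B, hB, rfl⟩ := mem_image.1 (mem_coe.1 hB')
  unfold shiftSet
  split_ifs with h1 h2 h2
  · exact fun h => disjoint_left.1 h (mem_insert_self _ _) (mem_insert_self _ _)
  · exact fun h => key B hB A hA h2 h1 h.symm
  · exact key A hA B hB h1 h2
  · exact h𝒢 hA hB

/-- Shifting introduces no element except i, so only at i can the number of avoiding members drop.
-/
lemma card_filter_notMem_le_shiftFamily (hv : v ≠ i) :
    #(𝒢.filter (v ∉ ·)) ≤ #((shiftFamily i j 𝒢).filter (v ∉ ·)) := by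
  refine card_le_card_of_injOn (shiftSet i j 𝒢) (fun A hA => ?_)
    (shiftSet_injOn.mono (coe_subset.2 (filter_subset _ _)))
  obtain ⟨hA, hvA⟩ := mem_filter.1 (mem_coe.1 hA)
  refine mem_coe.2 (mem_filter.2 ⟨mem_image_of_mem _ hA, ?_⟩)
  unfold shiftSet
  split_ifs
  · simp [hv, hvA]
  · exact hvA

/-- Members missing both i and j are fixed by the shift. -/
lemma card_link_pair_empty_le_shiftFamily :
    #(link 𝒢 {i, j} ∅) ≤ #((shiftFamily i j 𝒢).filter (i ∉ ·)) := by
  rw [card_link]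
  refine card_le_card fun A hA => ?_
  rw [mem_filter, ← disjoint_iff_inter_eq_empty] at hA
  obtain ⟨hA, hd⟩ := hA
  have hi : i ∉ A := fun h => disjoint_left.1 hd h (by simp)
  have hj : j ∉ A := fun h => disjoint_left.1 hd h (by simp)
  refine mem_filter.2 ⟨mem_image.2 ⟨A, hA, ?_⟩, hi⟩
  simp [shiftSet, hj]

/-- The sum of the values of `f` over all elements of all members of `𝒢`. -/
def familyWeight (f : α → ℕ) (𝒢 : Finset (Finset α)) : ℕ := ∑ A ∈ 𝒢, ∑ a ∈ A, f a

/-- This makes repeated shifting terminate. -/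
lemma familyWeight_shiftFamily_lt {f : α → ℕ} (hf : f i < f j) (hA : A ∈ 𝒢) (hj : j ∈ A)
    (hi : i ∉ A) (hA' : insert i (A.erase j) ∉ 𝒢) :
    familyWeight f (shiftFamily i j 𝒢) < familyWeight f 𝒢 := by
  have key : ∀ B : Finset α, j ∈ B → i ∉ B →
      ∑ a ∈ insert i (B.erase j), f a < ∑ a ∈ B, f a := fun B hj hi => by
    rw [sum_insert (by simp [hi]), ← add_sum_erase B f hj]
    omega
  rw [familyWeight, shiftFamily, sum_image shiftSet_injOn, familyWeight]
  refine sum_lt_sum (fun B _ => ?_) ⟨A, hA, ?_⟩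
  · unfold shiftSet
    split_ifs with h
    · exact (key B h.1 h.2.1).le
    · exact le_rfl
  · rw [shiftSet, if_pos ⟨hj, hi, hA'⟩]
    exact key A hj hi

end Shift

/-! ### Frankl's bound when every point is avoided by many members. -/

section MaxDegree

variable {n p q : ℕ}

lemma sized_of_subset_powersetCard {α : Type*} {𝒜 : Finset (Finset α)} {X : Finset α} {r : ℕ}
    (h : 𝒜 ⊆ powersetCard r X) : (𝒜 : Set (Finset α)).Sized r := fun _ hA =>
  (mem_powersetCard.1 (h hA)).2

/-- The form of `card_add_choose_le_lowerShadow` needed for complements: with r + 1 = p - q, b = q +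
1 and m = p, the condition m ≤ r + b holds with equality. -/
lemma card_add_choose_le_lowerShadow_compl {𝒜 : Finset (Finset (Fin n))}
    (h𝒜 : (𝒜 : Set (Finset (Fin n))).Sized (p - q)) (hn : p + 1 ≤ n) (hpq : 2 * q + 2 ≤ p)
    (hlo : p.choose q ≤ #𝒜) (hhi : #𝒜 ≤ (p + 1).choose (q + 1)) :
    #𝒜 + (p + 1).choose (q + 2) ≤ #(lowerShadow (q + 2) 𝒜) + (p + 1).choose (q + 1) := by
  obtain ⟨r, hr⟩ : ∃ r, p - q = r + 1 := ⟨p - q - 1, by omega⟩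
  have e1 : p.choose (r + 1) = p.choose q := Nat.choose_symm_of_eq_add (by omega)
  have e2 : (p + 1).choose (r + 1) = (p + 1).choose (q + 1) :=
    Nat.choose_symm_of_eq_add (by omega)
  rw [hr] at h𝒜
  have : #𝒜 + p.choose (q + 2) ≤ #(lowerShadow (q + 2) 𝒜) + p.choose (r + 1) :=
    card_add_choose_le_lowerShadow (b := q + 1) (m := p) h𝒜 (by omega) (by omega) hn
    (by omega) (e1 ▸ hlo) (e2 ▸ hhi)
  have p1 : (p + 1).choose (q + 2) = p.choose (q + 1) + p.choose (q + 2) := Nat.choose_succ_succ _ _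
  have p2 : (p + 1).choose (q + 1) = p.choose q + p.choose (q + 1) := Nat.choose_succ_succ _ _
  omega

/-- Cross-intersecting families that are both not too small have a bounded total size. -/
lemma card_add_card_le_of_cross {𝒜 ℬ : Finset (Finset (Fin n))} {X : Finset (Fin n)}
    (hX : #X = p + 2) (hpq : 2 * q + 2 ≤ p)
    (h𝒜 : 𝒜 ⊆ powersetCard (q + 2) X) (hℬ : ℬ ⊆ powersetCard (q + 2) X)
    (h : ∀ A ∈ 𝒜, ∀ B ∈ ℬ, ¬ Disjoint A B) (hA : p.choose q ≤ #𝒜) (hB : p.choose q ≤ #ℬ) :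
    #𝒜 + #ℬ ≤ 2 * (p + 1).choose (q + 1) := by
  wlog hle : #ℬ ≤ #𝒜 generalizing 𝒜 ℬ
  · rw [add_comm]
    exact this hℬ h𝒜 (fun A hA B hB hd => h B hB A hA hd.symm) hB hA (by omega)
  have hn : p + 2 ≤ n := by
    rw [← hX]
    simpa using card_le_univ X
  have hcross := card_add_card_lowerShadow_le h𝒜 h
  have hc := sized_of_subset_powersetCard (image_compl_subset hℬ)
  have hcard := card_image_compl hℬ
  rw [hX, show p + 2 - (q + 2) = p - q by omega] at hc
  have p1 : (p + 2).choose (q + 2) = (p + 1).choose (q + 1) + (p + 1).choose (q + 2) :=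
    Nat.choose_succ_succ _ _
  rw [hX] at hcross
  by_cases hhi : #ℬ ≤ (p + 1).choose (q + 1)
  · have := card_add_choose_le_lowerShadow_compl hc (by omega) hpq (by omega) (by omega)
    omega
  -- Here the shadow has at least C(p+1, q+2) sets, so #𝒜 ≤ C(p+1, q+1) < #ℬ, against the choice of
  -- ℬ as the smaller family.
  · have e2 : (p + 1).choose (p - q) = (p + 1).choose (q + 1) :=
      Nat.choose_symm_of_eq_add (by omega)
    have := choose_le_lowerShadow (b := q + 2) (m := p + 1) hc (by omega) (by omega) (by omega)
      (by omega)
    omega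

/-- In this range each extra member avoiding i adds at least one set to the shadow of the
complements, and so costs a member through i; the total is largest at the lower end of the shadow
estimate. -/
lemma card_le_of_card_filter_notMem_mem_Icc {𝒢 : Finset (Finset (Fin (p + 4)))}
    (h𝒢 : (𝒢 : Set (Finset (Fin (p + 4)))).Sized (q + 3))
    (hint : (𝒢 : Set (Finset (Fin (p + 4)))).Intersecting) (hpq : 2 * q + 2 ≤ p)
    (i : Fin (p + 4)) (hlo : p.choose q ≤ #(𝒢.filter (i ∉ ·)))
    (hhi : #(𝒢.filter (i ∉ ·)) ≤ (p + 1).choose (q + 1)) :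
    #𝒢 ≤ (p + 2).choose (q + 1) + 2 * (p + 1).choose (q + 1) := by
  have hX : #({i}ᶜ : Finset (Fin (p + 4))) = p + 3 := by simp [card_compl]
  have h1 : link 𝒢 {i} {i} ⊆ powersetCard (q + 2) {i}ᶜ :=
    link_subset_powersetCard h𝒢 (Subset.refl _)
  have h0 : link 𝒢 {i} ∅ ⊆ powersetCard (q + 3) {i}ᶜ :=
    link_subset_powersetCard h𝒢 (empty_subset _)
  have hcross := card_add_card_lowerShadow_le h1
    (not_disjoint_of_mem_link hint (Subset.refl _) (empty_subset _) (by simp))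
  have hc := sized_of_subset_powersetCard (image_compl_subset h0)
  have hcard := card_image_compl h0
  rw [hX, show p + 3 - (q + 3) = p - q by omega] at hc
  rw [hX, card_link_singleton_singleton] at hcross
  rw [card_link_empty_singleton] at hcard
  have hsum := card_filter_add_card_filter_not (s := 𝒢) (i ∈ ·)
  have := card_add_choose_le_lowerShadow_compl hc (by omega) hpq (by omega) (by omega)
  have p1 : (p + 3).choose (q + 2) = (p + 2).choose (q + 1) + (p + 2).choose (q + 2) :=
    Nat.choose_succ_succ _ _
  have p2 : (p + 2).choose (q + 2) = (p + 1).choose (q + 1) + (p + 1).choose (q + 2) :=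
    Nat.choose_succ_succ _ _
  omega

lemma choose_le_choose_succ_of_two_mul_lt (hpq : 2 * q + 2 ≤ p) :
    p.choose q ≤ p.choose (q + 1) :=
  Nat.choose_le_succ_of_lt_half_left (by omega)

/-- Splitting an intersecting family by its traces on a pair. -/
lemma card_le_of_card_link_pair {𝒢 : Finset (Finset (Fin (p + 4)))}
    (h𝒢 : (𝒢 : Set (Finset (Fin (p + 4)))).Sized (q + 3))
    (hint : (𝒢 : Set (Finset (Fin (p + 4)))).Intersecting) (hpq : 2 * q + 2 ≤ p)
    {i j : Fin (p + 4)} (hij : i ≠ j) (hi : p.choose q ≤ #(link 𝒢 {i, j} {i}))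
    (hj : p.choose q ≤ #(link 𝒢 {i, j} {j}))
    (h0 : #(link 𝒢 {i, j} ∅) ≤
      #(lowerShadow (q + 1) ((link 𝒢 {i, j} ∅).image ({i, j}ᶜ \ ·)))) :
    #𝒢 ≤ (p + 2).choose (q + 1) + 2 * (p + 1).choose (q + 1) := by
  have hX : #({i, j}ᶜ : Finset (Fin (p + 4))) = p + 2 := by
    rw [card_compl, card_pair hij, Fintype.card_fin]; omega
  have hsi : ({i} : Finset (Fin (p + 4))) ⊆ {i, j} := by simp
  have hsj : ({j} : Finset (Fin (p + 4))) ⊆ {i, j} := by simp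
  have h1 := card_add_card_le_of_cross hX hpq (link_subset_powersetCard h𝒢 hsi)
    (link_subset_powersetCard h𝒢 hsj)
    (not_disjoint_of_mem_link hint hsi hsj (by simpa using hij)) hi hj
  have h2 : link 𝒢 {i, j} {i, j} ⊆ powersetCard (q + 1) {i, j}ᶜ := by
    have := link_subset_powersetCard h𝒢 (Subset.refl {i, j})
    rwa [card_pair hij] at this
  have hcross := card_add_card_lowerShadow_le h2
    (not_disjoint_of_mem_link hint (Subset.refl _) (empty_subset _) (by simp))
  rw [hX] at hcross
  have := sum_card_link_pair (𝒢 := 𝒢) hij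
  omega

/-- The complements of a shifted family are shifted for the reversed order. -/
lemma IsShiftedOn.image_compl {α β : Type*} [DecidableEq α] [LT β] {f : α → β} {X : Finset α}
    {𝒜 : Finset (Finset α)} {r : ℕ} (h𝒜 : 𝒜 ⊆ powersetCard r X) (h : IsShiftedOn f X 𝒜) :
    IsShiftedOn (OrderDual.toDual ∘ f) X (𝒜.image (X \ ·)) := by
  intro C hC i hi j hj hij hiC
  obtain ⟨A, hA, rfl⟩ := mem_image.1 hC
  have hAX := (mem_powersetCard.1 (h𝒜 hA)).1
  rw [mem_sdiff] at hj
  have hiA : i ∈ A := by simpa [hi] using hiC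
  refine mem_image.2 ⟨insert j (A.erase i), h A hA j hj.1 i hiA hij hj.2, ?_⟩
  have hne : i ≠ j := fun e => hj.2 (e ▸ hiA)
  ext x
  simp only [mem_sdiff, mem_insert, mem_erase]
  by_cases hxi : x = i
  · subst hxi
    simp [hi, hne]
  · by_cases hxj : x = j <;> simp [hxi, hxj, hne.symm]

lemma card_le_of_isShiftedOn {𝒢 : Finset (Finset (Fin (p + 4)))}
    (h𝒢 : (𝒢 : Set (Finset (Fin (p + 4)))).Sized (q + 3))
    (hint : (𝒢 : Set (Finset (Fin (p + 4)))).Intersecting) (hpq : 2 * q + 2 ≤ p)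
    (hγ : ∀ v, (p + 1).choose (q + 1) < #(𝒢.filter (v ∉ ·)))
    (hsh : IsShiftedOn (fun i : Fin (p + 4) => i) univ 𝒢) :
    #𝒢 ≤ (p + 2).choose (q + 1) + 2 * (p + 1).choose (q + 1) := by
  obtain ⟨i, hi⟩ : ∃ i : Fin (p + 4), (i : ℕ) = 0 := ⟨⟨0, by omega⟩, rfl⟩
  obtain ⟨j, hj⟩ : ∃ j : Fin (p + 4), (j : ℕ) = 1 := ⟨⟨1, by omega⟩, rfl⟩
  have hij : i ≠ j := fun h => by rw [h] at hi; omega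
  have hlt : ∀ y ∈ ({i, j} : Finset (Fin (p + 4))), ∀ x ∉ ({i, j} : Finset (Fin (p + 4))),
      y < x := by
    intro y hy x hx
    simp only [mem_insert, mem_singleton, not_or, Fin.ext_iff, Fin.lt_def] at hx hy ⊢
    omega
  have hX : #({i, j}ᶜ : Finset (Fin (p + 4))) = p + 2 := by
    rw [card_compl, card_pair hij, Fintype.card_fin]; omega
  set 𝒟 := link 𝒢 {i, j} ∅ with h𝒟
  have hmem : ∀ D, D ∈ 𝒟 ↔ Disjoint D {i, j} ∧ D ∈ 𝒢 := fun D => by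
    rw [h𝒟, mem_link (empty_subset _), union_empty]
  have hsub : 𝒟 ⊆ powersetCard (q + 3) {i, j}ᶜ := link_subset_powersetCard h𝒢 (empty_subset _)
  have hnot : ∀ D ∈ 𝒟, ∀ x ∈ D, x ∉ ({i, j} : Finset (Fin (p + 4))) := fun D hD x hx =>
    disjoint_left.1 ((hmem D).1 hD).1 hx
  have hmove : ∀ D ∈ 𝒟, ∀ x ∈ D, ∀ y ∈ ({i, j} : Finset (Fin (p + 4))),
      insert y (D.erase x) ∈ 𝒢 := fun D hD x hx y hy =>
    hsh D ((hmem D).1 hD).2 y (mem_univ _) x hx (hlt y hy x (hnot D hD x hx))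
      fun hyD => hnot D hD y hyD hy
  -- If A and B shared only x, replacing x by i in A would give a member disjoint from B.
  have hD2 : ∀ A ∈ 𝒟, ∀ B ∈ 𝒟, 2 ≤ #(A ∩ B) := by
    intro A hA B hB
    by_contra! hlt2
    have hne : (A ∩ B).Nonempty :=
      not_disjoint_iff_nonempty_inter.1 (hint ((hmem A).1 hA).2 ((hmem B).1 hB).2)
    have h1 : #(A ∩ B) = 1 := by have := card_pos.2 hne; omega
    obtain ⟨x, hx⟩ := card_eq_one.1 h1
    have hxA : x ∈ A := (mem_inter.1 (hx ▸ mem_singleton_self x)).1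
    refine hint (hmove A hA x hxA i (by simp)) ((hmem B).1 hB).2 ?_
    rw [disjoint_insert_left]
    refine ⟨fun hiB => hnot B hB i hiB (by simp), ?_⟩
    rw [disjoint_left]
    intro z hzA hzB
    have : z ∈ A ∩ B := mem_inter.2 ⟨mem_of_mem_erase hzA, hzB⟩
    rw [hx, mem_singleton] at this
    exact (mem_erase.1 hzA).1 this
  have hDsh : IsShiftedOn (fun i : Fin (p + 4) => i) {i, j}ᶜ 𝒟 := by
    intro A hA a ha b hb hab haA
    refine (hmem _).2 ⟨?_, hsh A ((hmem A).1 hA).2 a (mem_univ _) b hb hab haA⟩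
    rw [disjoint_insert_left]
    exact ⟨by simpa using ha, disjoint_of_subset_left (erase_subset _ _) ((hmem A).1 hA).1⟩
  -- Removing x from D ∈ 𝒟 and adding y gives a member, so the shadow of 𝒟 lies in the link of {y}.
  -- Hence each singleton link holds at least half of more than C(p+1, q+1) ≥ 2C(p, q) sets.
  have hshadow : ∀ y ∈ ({i, j} : Finset (Fin (p + 4))), #𝒟 ≤ #(link 𝒢 {i, j} {y}) := by
    intro y hy
    refine (card_le_lowerShadow_of_isShiftedOn Function.injective_id 1 {i, j}ᶜ (q + 3) (q + 2) 𝒟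
      hsub (by omega) (by omega) (fun A hA B hB => (hD2 A hA B hB).trans' (by omega))
      hDsh).trans (card_le_card fun E hE => ?_)
    obtain ⟨D, hD, hED, hE⟩ := mem_lowerShadow.1 hE
    have hDc := h𝒢 ((hmem D).1 hD).2
    have : #(D \ E) = 1 := by rw [card_sdiff_of_subset hED]; omega
    obtain ⟨x, hx⟩ := card_eq_one.1 this
    have hxD : x ∈ D := (mem_sdiff.1 (hx ▸ mem_singleton_self x)).1
    have hE' : E = D.erase x := by
      rw [erase_eq, ← hx, Finset.sdiff_sdiff_eq_self hED]
    refine (mem_link (by simpa using hy)).2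
      ⟨disjoint_of_subset_left hED ((hmem D).1 hD).1, ?_⟩
    rw [union_comm, singleton_union, hE']
    exact hmove D hD x hxD y hy
  have p2 : (p + 1).choose (q + 1) = p.choose q + p.choose (q + 1) := Nat.choose_succ_succ _ _
  have hq := choose_le_choose_succ_of_two_mul_lt hpq
  have hsi := hshadow i (by simp)
  have hsj := hshadow j (by simp)
  have hci := card_link_pair_empty_add (𝒢 := 𝒢) hij
  have hcj := card_link_pair_empty_add (𝒢 := 𝒢) hij.symm
  rw [pair_comm j i, ← h𝒟] at hcj
  rw [← h𝒟] at hci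
  have hγi := hγ i
  have hγj := hγ j
  refine card_le_of_card_link_pair h𝒢 hint hpq hij (by omega) (by omega) ?_
  rw [← h𝒟]
  -- Two members of 𝒟 have a union of at most 2q + 4 of the p + 2 points, so their complements share
  -- at least p - 2q - 2. This is exactly the drop in size from p - q - 1 to q + 1, and Katona's
  -- theorem applies in the reversed order.
  refine (card_image_compl hsub).ge.trans (card_le_lowerShadow_of_isShiftedOn
    (OrderDual.toDual.injective.comp Function.injective_id) (p - 2 * q - 2) {i, j}ᶜ (p - q - 1)
    (q + 1) _ ?_ (by omega) (by omega) ?_ (hDsh.image_compl hsub))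
  · have := image_compl_subset hsub
    rwa [hX, show p + 2 - (q + 3) = p - q - 1 by omega] at this
  · intro A' hA' B' hB'
    obtain ⟨A, hA, rfl⟩ := mem_image.1 hA'
    obtain ⟨B, hB, rfl⟩ := mem_image.1 hB'
    have hA1 := mem_powersetCard.1 (hsub hA)
    have hB1 := mem_powersetCard.1 (hsub hB)
    have h2 := hD2 A hA B hB
    have h3 := card_union_add_card_inter A B
    rw [← sdiff_union_distrib, card_sdiff_of_subset (union_subset hA1.1 hB1.1), hX]
    omega

/-- Frankl's theorem: an intersecting family in which every vertex is avoided by many members is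
at most as large as the family of sets that contain two of three given points. -/
theorem card_le_of_choose_lt_card_filter_notMem (hpq : 2 * q + 2 ≤ p)
    (𝒢 : Finset (Finset (Fin (p + 4)))) (h𝒢 : (𝒢 : Set (Finset (Fin (p + 4)))).Sized (q + 3))
    (hint : (𝒢 : Set (Finset (Fin (p + 4)))).Intersecting)
    (hγ : ∀ v, (p + 1).choose (q + 1) < #(𝒢.filter (v ∉ ·))) :
    #𝒢 ≤ (p + 2).choose (q + 1) + 2 * (p + 1).choose (q + 1) := by
  induction hw : familyWeight (fun i : Fin (p + 4) => (i : ℕ)) 𝒢 using Nat.strong_induction_on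
    generalizing 𝒢 with
  | _ w ih =>
    by_cases hsh : IsShiftedOn (fun i : Fin (p + 4) => i) univ 𝒢
    · exact card_le_of_isShiftedOn h𝒢 hint hpq hγ hsh
    unfold IsShiftedOn at hsh
    push Not at hsh
    obtain ⟨A, hA, i, -, j, hj, hij, hi, hA'⟩ := hsh
    have hwlt := familyWeight_shiftFamily_lt (f := fun i : Fin (p + 4) => (i : ℕ)) hij hA hj hi hA'
    have hsized := sized_shiftFamily (i := i) (j := j) h𝒢
    have hint' := intersecting_shiftFamily (i := i) (j := j) hint
    have hcard := card_shiftFamily (i := i) (j := j) (𝒢 := 𝒢)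
    rw [← hcard]
    by_cases hγ' : ∀ v, (p + 1).choose (q + 1) < #((shiftFamily i j 𝒢).filter (v ∉ ·))
    · exact ih _ (hw ▸ hwlt) _ hsized hint' hγ' rfl
    push Not at hγ'
    obtain ⟨v, hv⟩ := hγ'
    have hvi : v = i := by
      by_contra hvi
      have := card_filter_notMem_le_shiftFamily (𝒢 := 𝒢) (j := j) hvi
      have := hγ v
      omega
    subst hvi
    by_cases hlo : p.choose q ≤ #((shiftFamily v j 𝒢).filter (v ∉ ·))
    · exact card_le_of_card_filter_notMem_mem_Icc hsized hint' hpq v hlo hv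
    -- Now fewer than C(p, q) members of the unshifted 𝒢 miss both v and j, so each singleton link
    -- exceeds C(p+1, q+1) - C(p, q) = C(p, q+1) ≥ C(p, q). The split along {v, j} applies to 𝒢
    -- itself, with Kruskal–Katona replacing Katona's theorem.
    rw [hcard]
    have hne : v ≠ j := hij.ne
    have hD := card_link_pair_empty_le_shiftFamily (𝒢 := 𝒢) (i := v) (j := j)
    have p2 : (p + 1).choose (q + 1) = p.choose q + p.choose (q + 1) := Nat.choose_succ_succ _ _
    have hq := choose_le_choose_succ_of_two_mul_lt hpq
    have hcv := card_link_pair_empty_add (𝒢 := 𝒢) hne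
    have hcj := card_link_pair_empty_add (𝒢 := 𝒢) hne.symm
    rw [pair_comm j v] at hcj
    have hγv := hγ v
    have hγj := hγ j
    refine card_le_of_card_link_pair h𝒢 hint hpq hne (by omega) (by omega) ?_
    have hX : #({v, j}ᶜ : Finset (Fin (p + 4))) = p + 2 := by
      rw [card_compl, card_pair hne, Fintype.card_fin]; omega
    have hsub : link 𝒢 {v, j} ∅ ⊆ powersetCard (q + 3) {v, j}ᶜ :=
      link_subset_powersetCard h𝒢 (empty_subset _)
    have hc := sized_of_subset_powersetCard (image_compl_subset hsub)
    rw [hX, show p + 2 - (q + 3) = p - q - 1 by omega] at hc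
    have e : p.choose (p - q - 1) = p.choose (q + 1) := Nat.choose_symm_of_eq_add (by omega)
    have := card_le_lowerShadow_of_card_le (b := q + 1) (m := p) hc (by omega) (by omega)
      (by omega) (by rw [card_image_compl hsub, e]; omega)
    rwa [card_image_compl hsub] at this

end MaxDegree

/-! ### Double counting from degrees of `t`-sets to degrees of points. -/

section MinDegree

variable {n k t : ℕ} {F : Finset (Finset (Fin n))}

/-- Double counting of the pairs `S ⊆ A` with `A ∈ F` and `S` a `t`-set avoiding `x`. -/
lemma sum_setDegree_compl_singleton (hF : (F : Set (Finset (Fin n))).Sized k) (t : ℕ)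
    (x : Fin n) :
    ∑ S ∈ powersetCard t {x}ᶜ, setDegree F S =
      #(F.filter (x ∈ ·)) * (k - 1).choose t + #(F.filter (x ∉ ·)) * k.choose t := by
  have h1 : ∑ S ∈ powersetCard t {x}ᶜ, setDegree F S = ∑ A ∈ F, (#(A.erase x)).choose t := by
    simp only [setDegree, card_filter]
    rw [sum_comm]
    refine sum_congr rfl fun A _ => ?_
    rw [← card_filter, ← card_powersetCard]
    congr 1
    ext S
    simp only [mem_filter, mem_powersetCard, subset_erase, subset_compl_singleton]
    tauto
  rw [h1, ← sum_filter_add_sum_filter_not F (x ∈ ·)]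
  congr 1
  · rw [← smul_eq_mul, ← sum_const]
    refine sum_congr rfl fun A hA => ?_
    rw [card_erase_of_mem (mem_filter.1 hA).2, hF (mem_filter.1 hA).1]
  · rw [← smul_eq_mul, ← sum_const]
    refine sum_congr rfl fun A hA => ?_
    rw [erase_eq_of_notMem (mem_filter.1 hA).2, hF (mem_filter.1 hA).1]

lemma mul_choose_lt_of_lt_setDegree (hF : (F : Set (Finset (Fin n))).Sized k) (htk : t < k)
    (hkn : k ≤ n)
    (hdeg : ∀ S : Finset (Fin n), #S = t → (n - t - 1).choose (k - t - 1) < setDegree F S)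
    (x : Fin n) :
    (k - t) * (n - 1).choose (k - 1) <
      (k - t) * #(F.filter (x ∈ ·)) + k * #(F.filter (x ∉ ·)) := by
  obtain ⟨l, rfl⟩ : ∃ l, k = l + 1 := ⟨k - 1, by omega⟩
  obtain ⟨m, rfl⟩ : ∃ m, n = m + 1 := ⟨n - 1, by omega⟩
  have hcard : #({x}ᶜ : Finset (Fin (m + 1))) = m := by simp [card_compl]
  have hne : (powersetCard t ({x}ᶜ : Finset (Fin (m + 1)))).Nonempty :=
    powersetCard_nonempty.2 (by rw [hcard]; omega)
  have h1 := sum_lt_sum_of_nonempty hne fun S hS => hdeg S (mem_powersetCard.1 hS).2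
  rw [sum_const, smul_eq_mul, card_powersetCard, hcard, sum_setDegree_compl_singleton hF,
    show m + 1 - t - 1 = m - t by omega, show l + 1 - t - 1 = l - t by omega,
    ← Nat.choose_mul (by omega)] at h1
  have h2 := Nat.choose_mul_succ_eq l t
  simp only [Nat.add_sub_cancel] at h1 ⊢
  have hpos : 0 < l.choose t := Nat.choose_pos (by omega)
  have hpos' : 0 < l + 1 - t := by omega
  -- The common factor C(k-1, t) is cancelled, using (k-t)C(k,t) = kC(k-1,t).
  refine Nat.lt_of_mul_lt_mul_right (a := l.choose t) ?_
  calc (l + 1 - t) * m.choose l * l.choose t = (l + 1 - t) * (m.choose l * l.choose t) := by ring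
    _ < (l + 1 - t) * _ := Nat.mul_lt_mul_of_pos_left h1 hpos'
    _ = _ := by
      rw [mul_add, add_mul, mul_right_comm (l + 1) _ (l.choose t), mul_comm (l + 1) (l.choose t),
        h2]
      ring

lemma sum_card_filter_mem (hF : (F : Set (Finset (Fin n))).Sized k) :
    ∑ x, #(F.filter (x ∈ ·)) = k * #F := by
  simp only [card_filter]
  rw [sum_comm, mul_comm, ← smul_eq_mul, ← sum_const]
  refine sum_congr rfl fun A hA => ?_
  rw [← card_filter, filter_univ_mem, hF hA]

end MinDegree

/-! ### Numerical estimates, small k, and the conclusion. -/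

section Bounds

variable {p q t : ℕ} {F : Finset (Finset (Fin (p + 4)))}

lemma choose_lt_card_filter_notMem (hF : (F : Set (Finset (Fin (p + 4)))).Sized (q + 3))
    (hint : (F : Set (Finset (Fin (p + 4)))).Intersecting) (hpq : 2 * q + 2 ≤ p)
    (hcond : (q + 2) * (q + 3) ≤ (q + 3 - t) * (p - q)) (x : Fin (p + 4))
    (hx : (q + 3 - t) * (p + 3).choose (q + 2) <
      (q + 3 - t) * #(F.filter (x ∈ ·)) + (q + 3) * #(F.filter (x ∉ ·))) :
    (p + 1).choose (q + 1) < #(F.filter (x ∉ ·)) := by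
  by_contra! hle
  have hX : #({x}ᶜ : Finset (Fin (p + 4))) = p + 3 := by simp [card_compl]
  have h1 : link F {x} {x} ⊆ powersetCard (q + 2) {x}ᶜ :=
    link_subset_powersetCard hF (Subset.refl _)
  have h0 : link F {x} ∅ ⊆ powersetCard (q + 3) {x}ᶜ :=
    link_subset_powersetCard hF (empty_subset _)
  have hcross := card_add_card_lowerShadow_le h1
    (not_disjoint_of_mem_link hint (Subset.refl _) (empty_subset _) (by simp))
  have hc := sized_of_subset_powersetCard (image_compl_subset h0)
  have hcard := card_image_compl h0
  rw [hX, show p + 3 - (q + 3) = p - q by omega] at hc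
  rw [hX, card_link_singleton_singleton] at hcross
  rw [card_link_empty_singleton] at hcard
  have e1 : (p + 1).choose (p - q) = (p + 1).choose (q + 1) :=
    Nat.choose_symm_of_eq_add (by omega)
  have hkk := card_mul_choose_le_of_card_le (b := q + 2) (m := p + 1) hc (by omega) (by omega)
    (by omega)
  rw [hcard] at hkk
  generalize #(lowerShadow (q + 2) ((link F {x} ∅).image ({x}ᶜ \ ·))) = s at hcross hkk
  generalize #(F.filter (x ∉ ·)) = γ at *
  generalize #(F.filter (x ∈ ·)) = d at *
  obtain ⟨m, rfl⟩ : ∃ m, p = q + m + 1 := ⟨p - q - 1, by omega⟩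
  obtain ⟨u, rfl⟩ : ∃ u, m = q + 1 + u := ⟨m - q - 1, by omega⟩
  rw [show q + (q + 1 + u) + 1 - q = q + 1 + u + 1 by omega] at hkk hcond
  rw [show q + (q + 1 + u) + 1 + 1 - (q + 2) = q + 1 + u by omega,
    show q + 1 + u + 1 - (q + 2) = u by omega,
    Nat.choose_symm_of_eq_add (show q + 1 + u = u + (q + 1) by omega)] at hkk
  have e2 : (q + 1 + u + 1) * (q + 1 + u).choose (q + 1) =
      (q + 1 + u + 1).choose (q + 2) * (q + 2) := Nat.add_one_mul_choose_eq _ _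
  have hpos : 0 < (q + 1 + u).choose (q + 1) := Nat.choose_pos (by omega)
  -- This is the shadow ratio on p + 1 = n - 3 points: γ(n-k-1) ≤ s(k-1).
  have hγs : γ * (q + 1 + u + 1) ≤ s * (q + 2) := by
    refine Nat.le_of_mul_le_mul_right ?_ hpos
    calc γ * (q + 1 + u + 1) * (q + 1 + u).choose (q + 1)
        = γ * (q + 1 + u + 1).choose (q + 2) * (q + 2) := by rw [mul_assoc, e2, mul_assoc]
      _ ≤ s * (q + 1 + u).choose (q + 1) * (q + 2) := Nat.mul_le_mul_right _ hkk
      _ = _ := by ring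
  have hlt : (q + 3 - t) * s < (q + 3) * γ := by
    have := Nat.mul_le_mul_left (q + 3 - t) hcross
    rw [mul_add] at this
    omega
  have h2 : (q + 2) * ((q + 3 - t) * s) < (q + 2) * ((q + 3) * γ) :=
    Nat.mul_lt_mul_of_pos_left hlt (by omega)
  have h3 := Nat.mul_le_mul_left (q + 3 - t) hγs
  have h4 := Nat.mul_le_mul_right γ hcond
  nlinarith

lemma mul_choose_le (hqp : q ≤ p)
    (hcond : (q + 3) * (p + 4 - t) * ((q + 2) * (3 * p + 4 - 2 * q)) ≤
      (p + 4) * (q + 3 - t) * ((p + 3) * (p + 2))) :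
    (q + 3) * (p + 4 - t) * ((p + 2).choose (q + 1) + 2 * (p + 1).choose (q + 1)) ≤
      (p + 4) * (q + 3 - t) * (p + 3).choose (q + 2) := by
  have e1 : (p + 3) * (p + 2).choose (q + 1) = (p + 3).choose (q + 2) * (q + 2) :=
    Nat.add_one_mul_choose_eq _ _
  have e2 : (p + 1).choose (q + 1) * (p + 2) = (p + 2).choose (q + 1) * (p + 2 - (q + 1)) :=
    Nat.choose_mul_succ_eq _ _
  set c := (p + 2).choose (q + 1)
  have e3 : (c + 2 * (p + 1).choose (q + 1)) * (p + 2) = c * (3 * p + 4 - 2 * q) := by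
    rw [add_mul, mul_assoc, e2, show 3 * p + 4 - 2 * q = p + 2 + 2 * (p + 2 - (q + 1)) by omega]
    ring
  refine Nat.le_of_mul_le_mul_right (c := (p + 2) * (q + 2)) ?_ (by positivity)
  calc (q + 3) * (p + 4 - t) * (c + 2 * (p + 1).choose (q + 1)) * ((p + 2) * (q + 2))
      = (q + 3) * (p + 4 - t) * ((c + 2 * (p + 1).choose (q + 1)) * (p + 2)) * (q + 2) := by ring
    _ = (q + 3) * (p + 4 - t) * ((q + 2) * (3 * p + 4 - 2 * q)) * c := by rw [e3]; ring
    _ ≤ (p + 4) * (q + 3 - t) * ((p + 3) * (p + 2)) * c := Nat.mul_le_mul_right _ hcond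
    _ = (p + 4) * (q + 3 - t) * ((p + 3) * c) * (p + 2) := by ring
    _ = _ := by rw [e1]; ring

theorem exists_setDegree_le_of_three_le {n k : ℕ} {F : Finset (Finset (Fin n))}
    (hF : (F : Set (Finset (Fin n))).Sized k)
    (hint : (F : Set (Finset (Fin n))).Intersecting) (hk : 3 ≤ k) (ht : t < k)
    (hn : 2 * k + 2 ≤ n) (hcond : t = 1 ∨ 3 * t * k ≤ (n - 2 * k) * (k - t)) :
    ∃ S : Finset (Fin n), #S = t ∧ setDegree F S ≤ (n - t - 1).choose (k - t - 1) := by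
  by_contra! hdeg
  obtain ⟨q, rfl⟩ : ∃ q, k = q + 3 := ⟨k - 3, by omega⟩
  obtain ⟨p, rfl⟩ : ∃ p, n = p + 4 := ⟨n - 4, by omega⟩
  have havg : ∀ x, (q + 3 - t) * (p + 3).choose (q + 2) <
      (q + 3 - t) * #(F.filter (x ∈ ·)) + (q + 3) * #(F.filter (x ∉ ·)) :=
    mul_choose_lt_of_lt_setDegree hF ht (by omega) hdeg
  obtain ⟨w, hw⟩ : ∃ w, q + 3 = t + w := ⟨q + 3 - t, by omega⟩
  obtain ⟨s, hs⟩ : ∃ s, p + 4 = 2 * (q + 3) + s := ⟨p + 4 - 2 * (q + 3), by omega⟩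
  rw [show q + 3 - t = w by omega, show p + 4 - 2 * (q + 3) = s by omega] at hcond
  have hc1 : (q + 2) * (q + 3) ≤ (q + 3 - t) * (p - q) := by
    rw [show q + 3 - t = w by omega, show p - q = q + 2 + s by omega]
    rcases hcond with rfl | hcond
    · rw [show w = q + 2 by omega]
      exact Nat.mul_le_mul_left _ (by omega)
    · have : (q + 2) * (q + 3) = (q + 2) * t + (q + 2) * w := by rw [hw]; ring
      nlinarith
  have hc2 : (q + 3) * (p + 4 - t) * ((q + 2) * (3 * p + 4 - 2 * q)) ≤
      (p + 4) * (q + 3 - t) * ((p + 3) * (p + 2)) := by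
    have hp : p = 2 * q + 2 + s := by omega
    rw [show q + 3 - t = w by omega, show p + 4 - t = q + 3 + s + w by omega,
      show 3 * p + 4 - 2 * q = 4 * q + 10 + 3 * s by omega]
    -- With s = n - 2k and w = k - t, the identities k(n-t) = nw + t(n-k) and (n-1)(n-2) =
    -- (k-1)(3n-2k-2) + (n-k)s reduce the claim to this. Given sw ≥ 3tk, the bound (k-1)(3n-2k-2) ≤
    -- 3nk suffices, which accounts for the constant 3.
    have key : t * ((q + 2) * (4 * q + 10 + 3 * s)) ≤ (p + 4) * (s * w) := by
      rcases hcond with rfl | hcond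
      · rw [show w = q + 2 by omega, hp]
        obtain ⟨u, rfl⟩ : ∃ u, s = u + 2 := ⟨s - 2, by omega⟩
        -- For t = 1 this reads 3n - 2k - 2 ≤ n(n - 2k), an equality at n = 2k + 2.
        have h : 4 * q + 10 + 3 * (u + 2) ≤ (2 * q + 2 + (u + 2) + 4) * (u + 2) := by
          nlinarith [Nat.zero_le (q * u), Nat.zero_le (u * u)]
        linarith [Nat.mul_le_mul_left (q + 2) h]
      · calc t * ((q + 2) * (4 * q + 10 + 3 * s)) ≤ (p + 4) * (3 * t * (q + 3)) := by
              rw [hp]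
              nlinarith [Nat.zero_le (t * q * q), Nat.zero_le (t * q), Nat.zero_le (t * s),
                Nat.zero_le (t * q * s)]
          _ ≤ _ := Nat.mul_le_mul_left _ hcond
    have e : (q + 3) * (q + 3 + s + w) = (p + 4) * w + t * (q + 3 + s) := by
      rw [hp]
      have : (q + 3) * (q + 3 + s) = (t + w) * (q + 3 + s) := by rw [hw]
      linarith
    have e' : (p + 3) * (p + 2) = (q + 2) * (4 * q + 10 + 3 * s) + (q + 3 + s) * s := by
      rw [hp]; ring
    rw [e, e']
    have := Nat.mul_le_mul_left (q + 3 + s) key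
    linarith
  have hγ : ∀ x, (p + 1).choose (q + 1) < #(F.filter (x ∉ ·)) := fun x =>
    choose_lt_card_filter_notMem hF hint (by omega) hc1 x (havg x)
  have hT := card_le_of_choose_lt_card_filter_notMem (by omega) F hF hint hγ
  have hsum := sum_lt_sum_of_nonempty (univ_nonempty (α := Fin (p + 4))) fun x _ => havg x
  have hco : ∑ x, #(F.filter (x ∉ ·)) + (q + 3) * #F = (p + 4) * #F := by
    rw [← sum_card_filter_mem hF, ← sum_add_distrib]
    simp_rw [add_comm (#(F.filter (_ ∉ ·))), card_filter_add_card_filter_not]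
    simp
  rw [sum_const, card_univ, Fintype.card_fin, smul_eq_mul, sum_add_distrib, ← mul_sum, ← mul_sum,
    sum_card_filter_mem hF] at hsum
  have h1 := mul_choose_le (p := p) (q := q) (t := t) (by omega) hc2
  have h2 := Nat.mul_le_mul_left ((q + 3) * (p + 4 - t)) hT
  have h3 : (q + 3) * _ = (q + 3) * _ := congrArg ((q + 3) * ·) hco
  rw [show q + 3 - t = w by omega] at *
  have h4 : (q + 3) * (p + 4 - t) * #F + (q + 3) * (q + 3) * #F =
      (q + 3) * (p + 4) * #F + w * (q + 3) * #F := by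
    rw [← add_mul, ← add_mul, ← mul_add, show p + 4 - t + (q + 3) = p + 4 + w by omega]
    ring
  nlinarith

/-- If all degrees were at least 2, every x outside an edge ab would be joined to both a and b. Two
outside points x, y would then give the disjoint edges xa and yb. -/
lemma exists_setDegree_le_one {n : ℕ} {F : Finset (Finset (Fin n))}
    (hF : (F : Set (Finset (Fin n))).Sized 2)
    (hint : (F : Set (Finset (Fin n))).Intersecting) (hn : 4 ≤ n) :
    ∃ S : Finset (Fin n), #S = 1 ∧ setDegree F S ≤ 1 := by
  by_contra! hdeg
  have hpair : ∀ x, ∀ A ∈ F, x ∉ A → ∀ a ∈ A, ({x, a} : Finset (Fin n)) ∈ F := by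
    intro x A hA hxA a ha
    obtain ⟨B, hB, C, hC, hBC⟩ := one_lt_card.1 (hdeg {x} (card_singleton x))
    have key : ∀ B ∈ F.filter ({x} ⊆ ·), ∃ b ∈ A, B = {x, b} := by
      intro B hB
      obtain ⟨hB, hxB⟩ := mem_filter.1 hB
      obtain ⟨b, hbA, hbB⟩ := not_disjoint_iff.1 (hint hA hB)
      have hxb : x ≠ b := fun h => hxA (h ▸ hbA)
      refine ⟨b, hbA, (eq_of_subset_of_card_le ?_ ?_).symm⟩
      · exact insert_subset (singleton_subset_iff.1 hxB) (singleton_subset_iff.2 hbB)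
      · rw [hF hB, card_pair hxb]
    obtain ⟨b, hb, rfl⟩ := key B hB
    obtain ⟨c, hc, rfl⟩ := key C hC
    have hbc : b ≠ c := fun h => hBC (by rw [h])
    have hA' : ({b, c} : Finset (Fin n)) = A :=
      eq_of_subset_of_card_le (insert_subset hb (singleton_subset_iff.2 hc))
        (by rw [hF hA, card_pair hbc])
    rw [← hA', mem_insert, mem_singleton] at ha
    rcases ha with rfl | rfl
    · exact (mem_filter.1 hB).1
    · exact (mem_filter.1 hC).1
  obtain ⟨A, hA⟩ := card_pos.1 ((Nat.zero_lt_one).trans (hdeg {⟨0, by omega⟩} (card_singleton _)))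
  have hA := (mem_filter.1 hA).1
  have hAc : 1 < #Aᶜ := by
    rw [card_compl, hF hA, Fintype.card_fin]
    omega
  obtain ⟨x, hx, y, hy, hxy⟩ := one_lt_card.1 hAc
  obtain ⟨a, ha, b, hb, hab⟩ := one_lt_card.1 (show 1 < #A by rw [hF hA]; omega)
  rw [mem_compl] at hx hy
  refine hint (hpair x A hA hx a ha) (hpair y A hA hy b hb) ?_
  have hxb : x ≠ b := fun h => hx (h ▸ hb)
  have hay : a ≠ y := fun h => hy (h ▸ ha)
  simp [hxy.symm, hxb.symm, hay.symm, hab.symm]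

lemma exists_setDegree_eq_zero {n : ℕ} {F : Finset (Finset (Fin n))}
    (hF : (F : Set (Finset (Fin n))).Sized 1)
    (hint : (F : Set (Finset (Fin n))).Intersecting) (hn : 2 ≤ n) :
    ∃ S : Finset (Fin n), #S = 1 ∧ setDegree F S = 0 := by
  by_contra! hdeg
  have hmem : ∀ x, ({x} : Finset (Fin n)) ∈ F := by
    intro x
    obtain ⟨A, hA⟩ := card_pos.1 (Nat.pos_of_ne_zero (hdeg {x} (card_singleton x)))
    obtain ⟨hA, hxA⟩ := mem_filter.1 hA
    rwa [eq_of_subset_of_card_le hxA (by rw [hF hA, card_singleton])]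
  refine hint (hmem (⟨0, by omega⟩ : Fin n)) (hmem (⟨1, by omega⟩ : Fin n)) ?_
  simp

lemma minDegree_le {n d : ℕ} {F : Finset (Finset (Fin n))}
    (h : ∃ S : Finset (Fin n), #S = t ∧ setDegree F S ≤ d) : minDegree F t ≤ d := by
  obtain ⟨S, hS, hd⟩ := h
  have hmem : setDegree F S ∈ {d | ∃ S : Finset (Fin n), #S = t ∧ setDegree F S = d} :=
    ⟨S, hS, rfl⟩
  exact (Nat.sInf_le hmem).trans hd

theorem minDegree_le_choose {n k : ℕ} {F : Finset (Finset (Fin n))}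
    (hF : (F : Set (Finset (Fin n))).Sized k)
    (hint : (F : Set (Finset (Fin n))).Intersecting) (ht1 : 1 ≤ t) (ht : t < k)
    (hn : 2 * k + 2 ≤ n) (hcond : t = 1 ∨ 3 * t * k ≤ (n - 2 * k) * (k - t)) :
    minDegree F t ≤ (n - t - 1).choose (k - t - 1) := by
  refine minDegree_le ?_
  rcases Nat.lt_or_ge k 3 with hk | hk
  · obtain rfl : k = 2 := by omega
    obtain rfl : t = 1 := by omega
    simpa using exists_setDegree_le_one hF hint (by omega)
  · exact exists_setDegree_le_of_three_le hF hint hk ht hn hcond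

lemma binom_sub_of_lt (m : ℕ) {k : ℕ} (h : t < k) :
    binom m ((k : ℤ) - (t : ℤ) - 1) = m.choose (k - t - 1) := by
  have e : (k : ℤ) - (t : ℤ) - 1 = ((k - t - 1 : ℕ) : ℤ) := by omega
  rw [binom, e, if_neg (by omega), Int.toNat_natCast]

end Bounds

theorem mainTheorem5 (n k : ℕ) (F : Finset (Finset (Fin n)))
    (hsize : ∀ A ∈ F, A.card = k)
    (hint : (F : Set (Finset (Fin n))).Intersecting) :
    (2 < 2 * k + 2 → 2 * k + 2 ≤ n →
      minDegree F 1 ≤ binom (n - 2) ((k : ℤ) - 2)) ∧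
    (∀ t : ℕ, 1 ≤ t → t < k →
      2 * (k : ℝ) + 3 * (t : ℝ) / (1 - (t : ℝ) / (k : ℝ)) ≤ (n : ℝ) →
      minDegree F t ≤ binom (n - t - 1) ((k : ℤ) - (t : ℤ) - 1)) := by
  have hF : (F : Set (Finset (Fin n))).Sized k := fun A hA => hsize A hA
  refine ⟨fun hk hn => ?_, fun t ht1 htk hn => ?_⟩
  · rcases Nat.lt_or_ge 1 k with hk1 | hk1
    · have h := minDegree_le_choose hF hint le_rfl hk1 hn (Or.inl rfl)
      rw [← binom_sub_of_lt _ hk1, Nat.sub_sub] at h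
      convert h using 2
      push_cast
      ring
    · obtain rfl : k = 1 := by omega
      obtain ⟨S, hS, h0⟩ := exists_setDegree_eq_zero hF hint (by omega)
      exact (minDegree_le ⟨S, hS, h0.le⟩).trans (Nat.zero_le _)
  · rw [binom_sub_of_lt _ htk]
    have hk0 : (0 : ℝ) < k := by exact_mod_cast (by omega : 0 < k)
    have hkt : (0 : ℝ) < k - t := sub_pos.2 (by exact_mod_cast htk)
    have e : 3 * (t : ℝ) / (1 - (t : ℝ) / (k : ℝ)) = 3 * t * k / (k - t) := by
      rw [one_sub_div hk0.ne', div_div_eq_mul_div]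
    rw [e] at hn
    have h1 : 3 * (t : ℝ) * k ≤ (n - 2 * k) * (k - t) := by
      rw [← div_le_iff₀ hkt]
      linarith
    -- Since tk ≥ k > k - t, the hypothesis forces n ≥ 2k + 3, so part (2) satisfies the size
    -- condition of `minDegree_le_choose`.
    have h2 : 3 ≤ 3 * (t : ℝ) * k / (k - t) := by
      rw [le_div_iff₀ hkt]
      have : (1 : ℝ) ≤ t := by exact_mod_cast ht1
      nlinarith
    have h3 : 2 * k + 3 ≤ n := by
      have : 2 * (k : ℝ) + 3 ≤ n := by linarith
      exact_mod_cast this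
    refine minDegree_le_choose hF hint ht1 htk (by omega) (Or.inr ?_)
    have : ((3 * t * k : ℕ) : ℝ) ≤ ((n - 2 * k) * (k - t) : ℕ) := by
      rw [Nat.cast_mul (n - 2 * k), Nat.cast_sub (by omega), Nat.cast_sub htk.le]
      push_cast
      exact h1
    exact_mod_cast this
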